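/- Let $P_7$ be the chordless path on $7$ vertices and let $S_{1,2,3}$ be the tree with exactly three leaves, which are at distances $1$, $2$ and $3$ from its only vertex of degree $3$. Call a graph $H$-free if it has no induced subgraph isomorphic to $H$. The class of all finite bipartite graphs (undirected, without loops or multiple edges) that are both $P_7$-free and $S_{1,2,3}$-free is well-quasi-ordered by the induced subgraph relation: for every infinite sequence $G_0,G_1,G_2,\ldots$ of graphs in this class there are indices $i<j$ such that $G_i$ is isomorphic to an induced subgraph of $G_j$ (equivalently, the class contains neither an infinite antichain nor an infinite strictly decreasing sequence with respect to this quasi-order). -/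

import Mathlib

universe u v

/-- A finite simple graph, bundled with its vertex type. -/
structure FiniteGraph : Type (u + 1) where
  V : Type u
  finite : Finite V
  graph : SimpleGraph V

/-- `G` is isomorphic to an induced subgraph of `H`. -/
def FiniteGraph.IsInducedSubgraph (G H : FiniteGraph.{u}) : Prop :=
  G.graph.IsIndContained H.graph

/-- The induced subgraph relation is a quasi-order. -/
instance : IsPreorder FiniteGraph.{u} FiniteGraph.IsInducedSubgraph where
  refl G := SimpleGraph.IsIndContained.refl G.graph
  trans _ _ _ h₁ h₂ := SimpleGraph.IsIndContained.trans h₁ h₂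

/-- `G` contains no copy of `H` as an induced subgraph. -/
def SimpleGraph.IsInducedFree {V : Type u} {W : Type v} (G : SimpleGraph V)
    (H : SimpleGraph W) : Prop :=
  ¬ H.IsIndContained G

/-- The tree `S_{1,2,3}` with exactly three leaves, at distances `1`, `2`, `3` from its only vertex
of degree `3`. The centre is `0`, and the three branches are `1`; `2, 3`; `4, 5, 6`. -/
def graphS123 : SimpleGraph (Fin 7) :=
  SimpleGraph.fromEdgeSet {s(0, 1), s(0, 2), s(2, 3), s(0, 4), s(4, 5), s(5, 6)}

/-- The class of finite `(P_7, S_{1,2,3})`-free bipartite graphs. -/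
def P7S123FreeBipartite : Set FiniteGraph.{u} :=
  {G | G.graph.IsBipartite ∧ G.graph.IsInducedFree (SimpleGraph.pathGraph 7) ∧
    G.graph.IsInducedFree graphS123}

/-! Fix proper `2`-colourings. By `IsP7S123Free.exists_isSplit`, every graph of the class with at
least two vertices splits into two nonempty parts so that adjacency across depends only on colours.
There are four patterns, and colour-preserving embeddings of the parts glue when the patterns agree
(`ColouredGraph.embeds_of_isSplit`), so a minimal bad sequence is impossible.

For the split, suppose that a smallest `G` has none. Splits whose pattern differs on the two colours
are the one-way cuts of the bipartite tournament `OrientedArc`, which is therefore strong. By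
`IsBipartiteTournament.exists_strongOn_compl_singleton`, either two vertices split off from the
rest, or some `G - v` stays strong. In the latter case `G - v` has a split, necessarily with equal
values on both colours: `G - v` or its bipartite complement is disconnected. The forbidden graphs
are self-complementary in the bipartite sense, so let `G - v` be disconnected. Then
`IsP7S123Free.not_isConn_bipCompl` disconnects the bipartite complement of `G`, which is a split
after all. -/

theorem Bool.eq_of_ne_of_ne' {a b k : Bool} (ha : a ≠ k) (hb : b ≠ k) : a = b := by
  cases a <;> cases b <;> cases k <;> simp_all

/-! ### Strongly connected bipartite tournaments -/

section Tournament

variable {V : Type*} {c : V → Bool} {T : V → V → Prop}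

/-- `T` is strongly connected on `H`: a nonempty subset of `H` that no arc inside `H` leaves is
all of `H`. -/
def StrongOn (T : V → V → Prop) (H : Set V) : Prop :=
  ∀ S ⊆ H, S.Nonempty → (∀ x ∈ S, ∀ y ∈ H, T x y → y ∈ S) → S = H

/-- The arcs of `T` join vertices of different colours, and every two vertices of different colours
are joined by exactly one arc. -/
structure IsBipartiteTournament (c : V → Bool) (T : V → V → Prop) : Prop where
  ne_of_arc : ∀ {x y}, T x y → c x ≠ c y
  arc_of_not : ∀ {x y}, c x ≠ c y → ¬ T x y → T y x
  asymm : ∀ {x y}, T x y → ¬ T y x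

theorem StrongOn.insert_of_arcs {H : Set V} (hH : StrongOn T H) {x y z : V} (hy : y ∈ H) (hz : z ∈ H)
    (hyx : T y x) (hxz : T x z) : StrongOn T (insert x H) := by
  intro S hS hne hcl
  have key : S ∩ H = H := by
    refine hH _ Set.inter_subset_right ?_ fun a ha b hb hab =>
      ⟨hcl a ha.1 b (Set.mem_insert_of_mem _ hb) hab, hb⟩
    obtain ⟨a, ha⟩ := hne
    rcases hS ha with rfl | h
    · exact ⟨z, hcl a ha z (Set.mem_insert_of_mem _ hz) hxz, hz⟩
    · exact ⟨a, ha, h⟩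
  have hHS : H ⊆ S := Set.inter_eq_right.1 key
  refine hS.antisymm (Set.insert_subset ?_ hHS)
  exact hcl y (hHS hy) x (Set.mem_insert _ _) hyx

theorem StrongOn.insert_insert_of_arcs {H : Set V} (hH : StrongOn T H) {x₁ x₂ y z : V} (hy : y ∈ H)
    (hz : z ∈ H) (hy₁ : T y x₁) (h₁₂ : T x₁ x₂) (h₂z : T x₂ z) :
    StrongOn T (insert x₁ (insert x₂ H)) := by
  intro S hS hne hcl
  have m₁ : x₁ ∈ (insert x₁ (insert x₂ H) : Set V) := by simp
  have m₂ : x₂ ∈ (insert x₁ (insert x₂ H) : Set V) := by simp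
  have mH : ∀ w ∈ H, w ∈ (insert x₁ (insert x₂ H) : Set V) := by simp_all
  have key : S ∩ H = H := by
    refine hH _ Set.inter_subset_right ?_ fun a ha b hb hab => ⟨hcl a ha.1 b (mH b hb) hab, hb⟩
    have h₂ : x₂ ∈ S → (S ∩ H).Nonempty := fun h => ⟨z, hcl _ h z (mH z hz) h₂z, hz⟩
    obtain ⟨a, ha⟩ := hne
    rcases hS ha with rfl | rfl | h
    · exact h₂ (hcl a ha _ m₂ h₁₂)
    · exact h₂ ha
    · exact ⟨a, ha, h⟩
  have hHS : H ⊆ S := Set.inter_eq_right.1 key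
  have h₁ := hcl y (hHS hy) x₁ m₁ hy₁
  exact hS.antisymm (Set.insert_subset h₁ (Set.insert_subset (hcl _ h₁ _ m₂ h₁₂) hHS))

theorem strongOn_four_cycle {a b a' b' : V} (h₁ : T a b) (h₂ : T b a') (h₃ : T a' b')
    (h₄ : T b' a) : StrongOn T {a, b, a', b'} := by
  intro S hS hne hcl
  have e₁ : a ∈ S → b ∈ S := fun h => hcl _ h _ (by simp) h₁
  have e₂ : b ∈ S → a' ∈ S := fun h => hcl _ h _ (by simp) h₂
  have e₃ : a' ∈ S → b' ∈ S := fun h => hcl _ h _ (by simp) h₃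
  have e₄ : b' ∈ S → a ∈ S := fun h => hcl _ h _ (by simp) h₄
  obtain ⟨x, hx⟩ := hne
  have ha : a ∈ S := by
    rcases hS hx with rfl | rfl | rfl | rfl <;> tauto
  refine hS.antisymm ?_
  rintro y (rfl | rfl | rfl | rfl) <;> tauto

theorem StrongOn.exists_arc_to [Nontrivial V] (h : StrongOn T Set.univ) (x : V) :
    ∃ y, T y x := by
  by_contra! hn
  obtain ⟨y, hy⟩ := exists_ne x
  have := h {x}ᶜ (Set.subset_univ _) ⟨y, hy⟩ (by
    rintro a - b - hab rfl
    exact hn a hab)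
  simp at this

/-- Take `a` with maximal out-neighbourhood in its colour class and walk back `a' → b' → a`. As `b'`
is an out-neighbour of `a'` but not of `a`, maximality gives an out-neighbour `b` of `a` that is not
one of `a'`. -/
theorem IsBipartiteTournament.exists_four_cycle [Finite V] [Nontrivial V]
    (hT : IsBipartiteTournament c T) (h : StrongOn T Set.univ) :
    ∃ a b a' b', T a b ∧ T b a' ∧ T a' b' ∧ T b' a := by
  obtain ⟨a₀⟩ : Nonempty V := inferInstance
  obtain ⟨a, ha, hmax⟩ := Set.Finite.exists_maximalFor (fun a => {b | T a b})
    {a | c a = c a₀} (Set.toFinite _) ⟨a₀, rfl⟩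
  obtain ⟨b', hb'⟩ := h.exists_arc_to a
  obtain ⟨a', ha'⟩ := h.exists_arc_to b'
  have hc : c a' = c a := Bool.eq_of_ne_of_ne' (hT.ne_of_arc ha') (hT.ne_of_arc hb').symm
  have : ¬ {b | T a b} ⊆ {b | T a' b} := fun hsub =>
    hT.asymm hb' (hmax (hc.trans ha) hsub ha')
  obtain ⟨b, hb, hb₂⟩ := Set.not_subset.1 this
  exact ⟨a, b, a', b', hb, hT.arc_of_not (hc ▸ hT.ne_of_arc hb) hb₂, ha', hb'⟩

/-- A strongly connected bipartite tournament stays strongly connected after the removal of a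
suitable vertex, unless it is the cyclic composition of an arc with the rest. -/
theorem IsBipartiteTournament.exists_strongOn_compl_singleton [Finite V] [Nontrivial V]
    (hT : IsBipartiteTournament c T) (h : StrongOn T Set.univ) :
    (∃ v, StrongOn T {v}ᶜ) ∨ ∃ x₁ x₂, c x₁ ≠ c x₂ ∧ ({x₁, x₂} : Set V)ᶜ.Nonempty ∧
      ∀ y, y ≠ x₁ → y ≠ x₂ → (c y ≠ c x₁ → T y x₁) ∧ (c y ≠ c x₂ → T x₂ y) := by
  obtain ⟨a, b, a', b', h₁, h₂, h₃, h₄⟩ := hT.exists_four_cycle h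
  by_cases huniv : ({a, b, a', b'} : Set V) = Set.univ
  · right
    have hab := hT.ne_of_arc h₁
    have hba := hT.ne_of_arc h₂
    have hab' := hT.ne_of_arc h₃
    have hba' := hT.ne_of_arc h₄
    refine ⟨b', a, hT.ne_of_arc h₄, ⟨b, ?_⟩, ?_⟩
    · rintro (rfl | rfl)
      · exact hT.asymm h₁ h₄
      · exact hab rfl
    · intro y hy₁ hy₂
      have : y ∈ ({a, b, a', b'} : Set V) := huniv ▸ Set.mem_univ y
      rcases this with rfl | rfl | rfl | rfl
      · exact absurd rfl hy₂
      · exact ⟨fun hc => absurd (Bool.eq_of_ne_of_ne' hab.symm hba') hc, fun _ => h₁⟩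
      · exact ⟨fun _ => h₃, fun hc => absurd (Bool.eq_of_ne_of_ne' hba.symm hab) hc⟩
      · exact absurd rfl hy₁
  -- Take a maximal proper strong set `H` containing both colours, so that every vertex is joined to
  -- `H` by an arc.
  · obtain ⟨H, ⟨hHs, hHu, p, q, hp, hq, hpq⟩, hmax⟩ := Set.Finite.exists_maximal
      (s := {H : Set V | StrongOn T H ∧ H ≠ Set.univ ∧ ∃ p q, p ∈ H ∧ q ∈ H ∧ c p ≠ c q})
      (Set.toFinite _) ⟨_, strongOn_four_cycle h₁ h₂ h₃ h₄, huniv, a, b, by simp, by simp,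
        hT.ne_of_arc h₁⟩
    have hext : ∀ x ∉ H, ∀ K, x ∈ K → H ⊆ K → StrongOn T K → K = Set.univ := by
      intro x hx K hxK hHK hK
      by_contra hne
      exact hx (hmax ⟨hK, hne, p, q, hHK hp, hHK hq, hpq⟩ hHK hxK)
    have hopp : ∀ x, ∃ y ∈ H, c y ≠ c x := fun x => by
      by_cases hx : c p = c x
      · exact ⟨q, hq, fun e => hpq (hx.trans e.symm)⟩
      · exact ⟨p, hp, hx⟩
    by_cases hx : ∃ x ∉ H, ∃ y ∈ H, ∃ z ∈ H, T y x ∧ T x z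
    · obtain ⟨x, hx, y, hy, z, hz, hyx, hxz⟩ := hx
      left
      refine ⟨x, ?_⟩
      have hK := hext x hx _ (Set.mem_insert x H) (Set.subset_insert _ _)
        (hHs.insert_of_arcs hy hz hyx hxz)
      have : ({x}ᶜ : Set V) = H := by
        ext w
        have : w ∈ insert x H := hK ▸ Set.mem_univ w
        simp only [Set.mem_insert_iff] at this
        simp only [Set.mem_compl_iff, Set.mem_singleton_iff]
        constructor
        · tauto
        · rintro hw rfl
          exact hx hw
      rwa [this]
    push Not at hx
    right
    -- Now no vertex outside `H` has arcs both from and to `H`. Without such an arc `x₁ → x₂`, the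
    -- outside vertices entered from `H` form a closed set; it misses `H`, so it is empty, and then
    -- `H` itself is closed.
    have harc : ∃ x₁ ∉ H, ∃ x₂ ∉ H, T x₁ x₂ ∧ (∃ y ∈ H, T y x₁) ∧ ∃ z ∈ H, T x₂ z := by
      by_contra! hno
      have hin : {x | x ∉ H ∧ ∃ y ∈ H, T y x} = ∅ := by
        by_contra hne
        have := h {x | x ∉ H ∧ ∃ y ∈ H, T y x} (Set.subset_univ _)
          (Set.nonempty_iff_ne_empty.2 hne) (by
            rintro x₁ ⟨hx₁, y, hy, hyx⟩ x₂ - h₁₂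
            have hx₂ : x₂ ∉ H := fun hx₂ => hx _ hx₁ _ hy _ hx₂ hyx h₁₂
            obtain ⟨w, hw, hwc⟩ := hopp x₂
            exact ⟨hx₂, w, hw, hT.arc_of_not hwc.symm (hno x₁ hx₁ x₂ hx₂ h₁₂ ⟨y, hy, hyx⟩ w hw)⟩)
        have hp' : p ∈ {x | x ∉ H ∧ ∃ y ∈ H, T y x} := this ▸ Set.mem_univ p
        exact hp'.1 hp
      refine hHu (h H (Set.subset_univ _) ⟨p, hp⟩ fun x hxH y _ hxy => ?_)
      by_contra hy
      have : y ∈ {x | x ∉ H ∧ ∃ y ∈ H, T y x} := ⟨hy, x, hxH, hxy⟩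
      simp [hin] at this
    obtain ⟨x₁, hx₁, x₂, hx₂, h₁₂, ⟨y, hy, hyx⟩, z, hz, hxz⟩ := harc
    have hK := hext x₁ hx₁ _ (Set.mem_insert x₁ _)
      ((Set.subset_insert x₂ H).trans (Set.subset_insert _ _))
      (hHs.insert_insert_of_arcs hy hz hyx h₁₂ hxz)
    have hmem : ∀ w, w ≠ x₁ → w ≠ x₂ → w ∈ H := fun w hw₁ hw₂ => by
      have : w ∈ insert x₁ (insert x₂ H) := hK ▸ Set.mem_univ w
      simpa [hw₁, hw₂] using this
    refine ⟨x₁, x₂, hT.ne_of_arc h₁₂, ⟨p, ?_⟩, fun w hw₁ hw₂ => ⟨fun hc => ?_, fun hc => ?_⟩⟩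
    · rintro (rfl | rfl)
      exacts [hx₁ hp, hx₂ hp]
    · exact hT.arc_of_not hc.symm (hx x₁ hx₁ y hy w (hmem w hw₁ hw₂) hyx)
    · exact hT.arc_of_not hc fun hw => hx x₂ hx₂ w (hmem w hw₁ hw₂) z hz hw hxz

end Tournament

/-! ### Forbidden subgraphs around a cut vertex -/

section Decomposition

variable {V : Type*} {c : V → Bool} {s : V → V → Prop}

/-- Relative to the colouring `c`, neither `P_7` nor `S_{1,2,3}` is induced by `s`; only pairs of
different colours count. -/
structure IsP7S123Free (c : V → Bool) (s : V → V → Prop) : Prop where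
  path : ∀ {k a₁ a₂ a₃ a₄ b₁ b₂ b₃}, c a₁ = k → c a₂ = k → c a₃ = k → c a₄ = k →
    c b₁ ≠ k → c b₂ ≠ k → c b₃ ≠ k → s a₁ b₁ → ¬ s a₁ b₂ → ¬ s a₁ b₃ → s a₂ b₁ → s a₂ b₂ →
    ¬ s a₂ b₃ → ¬ s a₃ b₁ → s a₃ b₂ → s a₃ b₃ → ¬ s a₄ b₁ → ¬ s a₄ b₂ → s a₄ b₃ → False
  star : ∀ {k x l m₁ m₂ t₁ t₂ t₃}, c x = k → c m₂ = k → c t₂ = k → c l ≠ k → c m₁ ≠ k →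
    c t₁ ≠ k → c t₃ ≠ k → s x l → s x m₁ → s x t₁ → ¬ s x t₃ → ¬ s m₂ l → s m₂ m₁ → ¬ s m₂ t₁ →
    ¬ s m₂ t₃ → ¬ s t₂ l → ¬ s t₂ m₁ → s t₂ t₁ → s t₂ t₃ → False

/-- The relation `s` defines a bipartite graph with parts the colour classes of `c`. -/
structure IsBicoloured (c : V → Bool) (s : V → V → Prop) : Prop where
  symm : ∀ {x y}, s x y → s y x
  ne : ∀ {x y}, s x y → c x ≠ c y

/-- The bipartite complement. -/
def BipCompl (c : V → Bool) (s : V → V → Prop) (x y : V) : Prop := c x ≠ c y ∧ ¬ s x y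

theorem IsBicoloured.bipCompl (h : IsBicoloured c s) : IsBicoloured c (BipCompl c s) :=
  ⟨fun h' => ⟨h'.1.symm, fun h'' => h'.2 (h.symm h'')⟩, fun h' => h'.1⟩

/-- The bipartite complements of `P_7` and `S_{1,2,3}` are again `P_7` and `S_{1,2,3}`, up to the
relabellings below. -/
theorem IsP7S123Free.bipCompl (h : IsP7S123Free c s) : IsP7S123Free c (BipCompl c s) where
  path {k a₁ a₂ a₃ a₄ b₁ b₂ b₃} := by
    rintro rfl h₂ h₃ h₄ g₁ g₂ g₃
    simp only [BipCompl, h₂, h₃, h₄, ne_eq, g₁.symm, g₂.symm, g₃.symm, not_false_eq_true,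
      true_and, not_not]
    intros
    exact h.path (k := c a₁) (a₁ := a₂) (b₁ := b₃) (a₂ := a₁) (b₂ := b₂) (a₃ := a₄) (b₃ := b₁)
      (a₄ := a₃) h₂ rfl h₄ h₃ g₃ g₂ g₁ ‹_› ‹_› ‹_› ‹_› ‹_› ‹_› ‹_› ‹_› ‹_› ‹_› ‹_› ‹_›
  star {k x l m₁ m₂ t₁ t₂ t₃} := by
    rintro rfl h₂ h₃ g₁ g₂ g₃ g₄
    simp only [BipCompl, h₂, h₃, ne_eq, g₁.symm, g₂.symm, g₃.symm, g₄.symm,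
      not_false_eq_true, true_and, not_not]
    intros
    exact h.star (k := c x) (x := m₂) (l := t₁) (m₁ := t₃) (m₂ := x) (t₁ := l) (t₂ := t₂)
      (t₃ := m₁) h₂ rfl h₃ g₃ g₄ g₁ g₂ ‹_› ‹_› ‹_› ‹_› ‹_› ‹_› ‹_› ‹_› ‹_› ‹_› ‹_› ‹_›

/-- Connectedness: a nonempty set of vertices that no edge leaves is the whole vertex set. -/
def IsConn (s : V → V → Prop) : Prop :=
  ∀ S : Set V, S.Nonempty → (∀ x ∈ S, ∀ y, s x y → y ∈ S) → S = Set.univ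

/-- In a connected bipartite graph, a vertex `v` that misses a vertex `m` of the other colour starts
an induced path with three edges, inside every union of components of `G - v` that contains `m`. -/
theorem IsConn.exists_path (hs : IsBicoloured c s) (hconn : IsConn s) {v m : V} {C : Set V}
    (hvC : v ∉ C) (hC : ∀ x ∈ C, ∀ y, s x y → y ≠ v → y ∈ C) (hm : m ∈ C) (hcm : c m ≠ c v)
    (hvm : ¬ s v m) :
    ∃ n ∈ C, ∃ a ∈ C, ∃ m' ∈ C, c a = c v ∧ c n ≠ c v ∧ c m' ≠ c v ∧
      s v n ∧ s n a ∧ s a m' ∧ ¬ s v m' := by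
  by_contra! hno
  -- Without the path, this set is closed under adjacency, hence contains `v`.
  have := hconn {y | y ∈ C ∧ ((c y ≠ c v ∧ ¬ s v y) ∨ c y = c v ∧ ∃ z ∈ C, c z ≠ c v ∧
    s y z ∧ ¬ s v z)} ⟨m, hm, Or.inl ⟨hcm, hvm⟩⟩ (by
      rintro x ⟨hxC, ⟨hx, hvx⟩ | ⟨hx, z, hzC, hz, hxz, hvz⟩⟩ y hxy
      · have hyv : y ≠ v := by
          rintro rfl
          exact hvx (hs.symm hxy)
        exact ⟨hC x hxC y hxy hyv, Or.inr ⟨Bool.eq_of_ne_of_ne' (hs.ne hxy).symm hx.symm, x, hxC,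
          hx, hs.symm hxy, hvx⟩⟩
      · have hy : c y ≠ c v := hx ▸ (hs.ne hxy).symm
        have hyC : y ∈ C := hC x hxC y hxy fun e => hy (e ▸ rfl)
        refine ⟨hyC, Or.inl ⟨hy, fun hvy => ?_⟩⟩
        exact hvz (hno y hyC x hxC z hzC hx hy hz hvy (hs.symm hxy) hxz))
  have hv := this ▸ Set.mem_univ v
  exact hvC hv.1

/-- The core of the decomposition: if `G` is connected and `G - v` is disconnected without isolated
vertices, and `v` misses a vertex of the other colour, then the bipartite complement of `G` is
disconnected. -/
theorem IsP7S123Free.not_isConn_bipCompl (hs : IsBicoloured c s) (hfree : IsP7S123Free c s)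
    (hconn : IsConn s) {v m : V} {C : Set V} (hvC : v ∉ C)
    (hC : ∀ x ∈ C, ∀ y, s x y → y ≠ v → y ∈ C) (hm : m ∈ C) (hcm : c m ≠ c v) (hvm : ¬ s v m)
    (hD : ∃ x ∉ C, x ≠ v) (hiso : ∀ x, x ≠ v → ∃ y, y ≠ v ∧ s x y) :
    ¬ IsConn (BipCompl c s) := by
  have hcol : ∀ {x y}, s x y → c x = c v → c y ≠ c v := fun h e e' => hs.ne h (e.trans e'.symm)
  have hcol' : ∀ {x y}, s x y → c x ≠ c v → c y = c v := fun h e =>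
    Bool.eq_of_ne_of_ne' (hs.ne h).symm e.symm
  -- no edges between `C` and the rest
  have hCD : ∀ {x y}, x ∈ C → y ∉ C → y ≠ v → ¬ s x y := fun hx hy hyv h => hy (hC _ hx _ h hyv)
  have hDC : ∀ {x y}, y ∈ C → x ∉ C → x ≠ v → ¬ s x y := fun hx hy hyv h =>
    hCD hx hy hyv (hs.symm h)
  obtain ⟨n₀, hn₀, x₀, hx₀, m₀, hm₀, hcx₀, hcn₀, hcm₀, hvn₀, hnx₀, hxm₀, hvm₀⟩ :=
    hconn.exists_path hs hvC hC hm hcm hvm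
  -- `v` dominates the rest
  have hdom : ∀ b ∉ C, c b ≠ c v → s v b := by
    intro b hb hcb
    by_contra hvb
    obtain ⟨n, ⟨hn, hnv⟩, a, ⟨ha, hav⟩, b', ⟨hb', hbv'⟩, hca, hcn, hcb', hvn, hna, hab, hvb'⟩ :=
      hconn.exists_path hs (v := v) (m := b) (C := {x | x ∉ C ∧ x ≠ v}) (by simp) (by
        rintro x ⟨hx, hxv⟩ y hxy hyv
        exact ⟨fun hy => hDC hy hx hxv hxy, hyv⟩) ⟨hb, fun e => hcb (e ▸ rfl)⟩ hcb hvb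
    -- Three-edge paths from `v` on both sides would join at `v` into an induced `P_7`.
    exact hfree.path (k := c n) (a₁ := b') (b₁ := a) (a₂ := n) (b₂ := v) (a₃ := n₀) (b₃ := x₀)
      (a₄ := m₀) (Bool.eq_of_ne_of_ne' hcb' hcn) rfl (Bool.eq_of_ne_of_ne' hcn₀ hcn)
      (Bool.eq_of_ne_of_ne' hcm₀ hcn) (hca ▸ hcn.symm) hcn.symm (hcx₀ ▸ hcn.symm) (hs.symm hab)
      (fun h => hvb' (hs.symm h)) (hDC hx₀ hb' hbv') hna (hs.symm hvn) (hDC hx₀ hn hnv)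
      (hCD hn₀ ha hav) (hs.symm hvn₀) hnx₀ (hCD hm₀ ha hav) (fun h => hvm₀ (hs.symm h))
      (hs.symm hxm₀)
  obtain ⟨a₂, ha₂, hav₂, hca₂, b₂, hb₂, hbv₂, hcb₂, hab₂⟩ : ∃ a₂, a₂ ∉ C ∧ a₂ ≠ v ∧ c a₂ = c v ∧
      ∃ b₂, b₂ ∉ C ∧ b₂ ≠ v ∧ c b₂ ≠ c v ∧ s a₂ b₂ := by
    obtain ⟨x, hx, hxv⟩ := hD
    obtain ⟨y, hyv, hxy⟩ := hiso x hxv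
    have hy : y ∉ C := fun hy => hDC hy hx hxv hxy
    by_cases hcx : c x = c v
    · exact ⟨x, hx, hxv, hcx, y, hy, hyv, hcol hxy hcx, hxy⟩
    · exact ⟨y, hy, hyv, hcol' hxy hcx, x, hx, hxv, hcx, hs.symm hxy⟩
  have hvb₂ := hdom b₂ hb₂ hcb₂
  -- Otherwise `v` is the centre of an `S_{1,2,3}` with branches `n'`; `b₂, a₂`; `n, x, m`.
  have hXN : ∀ x ∈ C, c x = c v → ∀ n ∈ C, c n ≠ c v → ∀ m ∈ C, c m ≠ c v → ∀ n' ∈ C, c n' ≠ c v →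
      s x n → s v n → s x m → ¬ s v m → s v n' → s x n' := by
    intro x hx hcx n hn hcn m hm hcm n' hn' hcn' hxn hvn hxm hvm hvn'
    by_contra hxn'
    exact hfree.star (k := c v) (x := v) (l := n') (m₁ := b₂) (m₂ := a₂) (t₁ := n) (t₂ := x)
      (t₃ := m) rfl hca₂ hcx hcn' hcb₂ hcn hcm hvn' hvb₂ hvn hvm (hDC hn' ha₂ hav₂) hab₂
      (hDC hn ha₂ hav₂) (hDC hm ha₂ hav₂) hxn' (hCD hx hb₂ hbv₂) hxn hxm
  -- every vertex of `C` has the expected neighbours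
  have hspan := hconn {y | y ∉ C ∨ (c y = c v ∧ ∃ n ∈ C, s v n ∧ s y n) ∨
    (c y ≠ c v ∧ (s v y ∨ ∃ x ∈ C, s x y ∧ ∃ n ∈ C, s v n ∧ s x n))} ⟨v, Or.inl hvC⟩ (by
      intro x hx y hxy
      by_cases hyC : y ∈ C
      swap
      · exact Or.inl hyC
      right
      rcases hx with hx | ⟨hcx, n, hn, hvn, hxn⟩ | ⟨hcx, hx⟩
      · obtain rfl : x = v := by
          by_contra hxv
          exact hDC hyC hx hxv hxy
        exact Or.inr ⟨(hs.ne hxy).symm, Or.inl hxy⟩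
      · refine Or.inr ⟨hcol hxy hcx, ?_⟩
        by_cases hxC : x ∈ C
        · exact Or.inr ⟨x, hxC, hxy, n, hn, hvn, hxn⟩
        · obtain rfl : x = v := by
            by_contra hxv
            exact hDC hyC hxC hxv hxy
          exact Or.inl hxy
      · have hcy := hcol' hxy hcx
        refine Or.inl ⟨hcy, ?_⟩
        have hxC : x ∈ C := hC y hyC x (hs.symm hxy) fun e => hcx (e ▸ rfl)
        by_cases hvx : s v x
        · exact ⟨x, hxC, hvx, hs.symm hxy⟩
        obtain ⟨a, ha, hax, n, hn, hvn, han⟩ := hx.resolve_left hvx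
        refine ⟨n, hn, hvn, ?_⟩
        by_contra hyn
        have hca := hcol' (hs.symm hax) hcx
        have hcn := hcol han hca
        -- A vertex `y` further away would give the induced path `a₂ b₂ v n a x y`.
        exact hfree.path (k := c v) (a₁ := a₂) (b₁ := b₂) (a₂ := v) (b₂ := n) (a₃ := a) (b₃ := x)
          (a₄ := y) hca₂ rfl hca hcy hcb₂ hcn hcx hab₂ (hDC hn ha₂ hav₂) (hDC hxC ha₂ hav₂) hvb₂
          hvn hvx (hCD ha hb₂ hbv₂) han hax (hCD hyC hb₂ hbv₂) hyn (hs.symm hxy))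
  have hX : ∀ x ∈ C, c x = c v → ∃ n ∈ C, s v n ∧ s x n := by
    intro x hx hcx
    have : x ∈ {y | y ∉ C ∨ (c y = c v ∧ ∃ n ∈ C, s v n ∧ s y n) ∨
      (c y ≠ c v ∧ (s v y ∨ ∃ x ∈ C, s x y ∧ ∃ n ∈ C, s v n ∧ s x n))} := hspan ▸ Set.mem_univ x
    rcases this with h | h | h
    exacts [absurd hx h, h.2, absurd hcx h.1]
  have hM : ∀ m ∈ C, c m ≠ c v → ¬ s v m → ∃ x ∈ C, s x m ∧ ∃ n ∈ C, s v n ∧ s x n := by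
    intro m hm hcm hvm
    have : m ∈ {y | y ∉ C ∨ (c y = c v ∧ ∃ n ∈ C, s v n ∧ s y n) ∨
      (c y ≠ c v ∧ (s v y ∨ ∃ x ∈ C, s x y ∧ ∃ n ∈ C, s v n ∧ s x n))} := hspan ▸ Set.mem_univ m
    rcases this with h | h | h
    exacts [absurd hm h, absurd h.1 hcm, h.2.resolve_left hvm]
  have hXM : ∀ z ∈ C, c z = c v → ∀ m ∈ C, c m ≠ c v → ¬ s v m → s z m := by
    intro z hz hcz m hm hcm hvm
    obtain ⟨n, hn, hvn, hzn⟩ := hX z hz hcz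
    obtain ⟨x, hx, hxm, n', hn', hvn', hxn'⟩ := hM m hm hcm hvm
    have hcx := hcol' (hs.symm hxm) hcm
    have hcn := hcol hzn hcz
    have hcn' := hcol hxn' hcx
    have hxn := hXN x hx hcx n' hn' hcn' m hm hcm n hn hcn hxn' hvn' hxm hvm hvn
    by_contra hzm
    exact hfree.star (k := c n) (x := n) (l := z) (m₁ := x) (m₂ := m) (t₁ := v) (t₂ := b₂)
      (t₃ := a₂) rfl (Bool.eq_of_ne_of_ne' hcm hcn) (Bool.eq_of_ne_of_ne' hcb₂ hcn)
      (hcz ▸ hcn.symm) (hcx ▸ hcn.symm) hcn.symm (hca₂ ▸ hcn.symm) (hs.symm hzn) (hs.symm hxn)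
      (hs.symm hvn) (hCD hn ha₂ hav₂) (fun h => hzm (hs.symm h)) (hs.symm hxm)
      (fun h => hvm (hs.symm h)) (hCD hm ha₂ hav₂) (hDC hz hb₂ hbv₂) (hDC hx hb₂ hbv₂)
      (hs.symm hvb₂) (hs.symm hab₂)
  have hC₁ : ∀ x ∈ C, c x = c v → ∀ y ∈ C, c y ≠ c v → s x y := by
    intro x hx hcx y hy hcy
    by_cases hvy : s v y
    · obtain ⟨n, hn, hvn, hxn⟩ := hX x hx hcx
      exact hXN x hx hcx n hn (hcol hxn hcx) m₀ hm₀ hcm₀ y hy hcy hxn hvn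
        (hXM x hx hcx m₀ hm₀ hcm₀ hvm₀) hvm₀ hvy
    · exact hXM x hx hcx y hy hcy hvy
  have hC₂ : ∀ x ∉ C, c x = c v → ∀ y ∉ C, c y ≠ c v → s x y := by
    intro x hx hcx y hy hcy
    by_cases hxv : x = v
    · exact hxv ▸ hdom y hy hcy
    have hyv : y ≠ v := fun e => hcy (e ▸ rfl)
    by_contra hxy
    obtain ⟨z, hzv, hxz⟩ := hiso x hxv
    have hz : z ∉ C := fun hz => hDC hz hx hxv hxz
    have hcz := hcol hxz hcx
    exact hfree.star (k := c v) (x := v) (l := y) (m₁ := z) (m₂ := x) (t₁ := n₀) (t₂ := x₀)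
      (t₃ := m₀) rfl hcx hcx₀ hcy hcz hcn₀ hcm₀ (hdom y hy hcy) (hdom z hz hcz) hvn₀ hvm₀ hxy hxz
      (hDC hn₀ hx hxv) (hDC hm₀ hx hxv) (hCD hx₀ hy hyv) (hCD hx₀ hz hzv) (hs.symm hnx₀) hxm₀
  intro hco
  -- Inside `C` and inside its complement all pairs of different colours are adjacent, so non-edges
  -- only run between the two, and this set is closed in the bipartite complement.
  have := hco {x | (x ∈ C ∧ c x = c v) ∨ (x ∉ C ∧ c x ≠ c v)} ⟨x₀, Or.inl ⟨hx₀, hcx₀⟩⟩ (by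
    rintro x (⟨hx, hcx⟩ | ⟨hx, hcx⟩) y ⟨hcxy, hxy⟩
    · have hcy : c y ≠ c v := fun h => hcxy (hcx.trans h.symm)
      exact Or.inr ⟨fun hy => hxy (hC₁ x hx hcx y hy hcy), hcy⟩
    · have hcy : c y = c v := Bool.eq_of_ne_of_ne' hcxy.symm hcx.symm
      refine Or.inl ⟨?_, hcy⟩
      by_contra hy
      exact hxy (hs.symm (hC₂ y hy hcy x hx hcx)))
  have hv : v ∈ {x | (x ∈ C ∧ c x = c v) ∨ (x ∉ C ∧ c x ≠ c v)} := this ▸ Set.mem_univ v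
  rcases hv with hv | hv
  exacts [hvC hv.1, hv.2 rfl]

end Decomposition

/-! ### Existence of splits -/

section Split

variable {V : Type*} {c : V → Bool} {s : V → V → Prop}

/-- `S` and `U \ S` are nonempty, and whether `x ∈ S` and `y ∈ U \ S` of different colours are
adjacent depends only on the colour of `x`, as told by `e`. So `S` and `U \ S` are separated by `s`,
or by its bipartite complement, or as in a `K + S` decomposition. -/
structure IsSplit (c : V → Bool) (s : V → V → Prop) (U S : Set V) (e : Bool → Prop) : Prop where
  subset : S ⊆ U
  nonempty : S.Nonempty
  ne : S ≠ U
  iff : ∀ x ∈ S, ∀ y ∈ U, y ∉ S → c x ≠ c y → (s x y ↔ e (c x))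

theorem IsSplit.bipCompl {U S : Set V} {e : Bool → Prop} (h : IsSplit c s U S e) :
    IsSplit c (BipCompl c s) U S fun k => ¬ e k :=
  ⟨h.subset, h.nonempty, h.ne, fun x hx y hy hyS hc => by
    simp [BipCompl, hc, h.iff x hx y hy hyS hc]⟩

theorem IsSplit.of_bipCompl {U S : Set V} {e : Bool → Prop} (h : IsSplit c (BipCompl c s) U S e) :
    IsSplit c s U S fun k => ¬ e k :=
  ⟨h.subset, h.nonempty, h.ne, fun x hx y hy hyS hc => by
    rw [← h.iff x hx y hy hyS hc]
    simp [BipCompl, hc]⟩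

/-- If all splits of `G - v` are of the same kind on both colours and `G - v` is disconnected, then
`G` has a split. -/
theorem IsP7S123Free.exists_isSplit_of_disconnected (hs : IsBicoloured c s)
    (hfree : IsP7S123Free c s) {v : V}
    (hv : ∀ S e, IsSplit c s {v}ᶜ S e → (e true ↔ e false)) {S : Set V} {e : Bool → Prop}
    (hS : IsSplit c s {v}ᶜ S e) (he : ∀ k, ¬ e k) : ∃ S e, IsSplit c s Set.univ S e := by
  by_contra! hno
  have hconn : IsConn s := by
    intro R hne hR
    by_contra hR'
    refine hno R (fun _ => False) ⟨Set.subset_univ _, hne, hR', fun x hx y _ hy _ => ?_⟩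
    exact iff_false_intro fun h => hy (hR x hx y h)
  have hco : IsConn (BipCompl c s) := by
    intro R hne hR
    by_contra hR'
    refine hno R (fun _ => True) ⟨Set.subset_univ _, hne, hR', fun x hx y _ hy hc => ?_⟩
    refine iff_true_intro ?_
    by_contra h
    exact hy (hR x hx y ⟨hc, h⟩)
  have hSv : v ∉ S := fun h => hS.subset h rfl
  obtain ⟨z, hzS⟩ := hS.nonempty
  obtain ⟨w, hwS, hwv⟩ : ∃ w, w ∉ S ∧ w ≠ v := by
    by_contra! h
    refine hS.ne (hS.subset.antisymm fun w hw => ?_)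
    by_contra hwS
    exact hw (h w hwS)
  have hadj : ∀ x ∈ S, ∀ y, s x y → y ≠ v → y ∈ S := by
    intro x hx y hxy hyv
    by_contra hy
    exact he _ ((hS.iff x hx y hyv hy (hs.ne hxy)).1 hxy)
  have hiso : ∀ x, x ≠ v → ∃ y, y ≠ v ∧ s x y := by
    intro x hxv
    by_contra! hx
    -- For a singleton only the value at `c x` is constrained; choosing the other value differently
    -- contradicts `hv`.
    have := hv {x} (fun k => k ≠ c x) ⟨by simpa using Ne.symm hxv, by simp, fun h => ?_, ?_⟩
    · cases hc : c x <;> simp [hc] at this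
    · have h₁ : z = x := h.symm.subset (hS.subset hzS)
      have h₂ : w = x := h.symm.subset hwv
      exact hwS (h₂.trans h₁.symm ▸ hzS)
    · rintro y rfl z hz - -
      simpa using hx z hz
  obtain ⟨m, hcm, hvm⟩ : ∃ m, c m ≠ c v ∧ ¬ s v m := by
    by_contra! h
    refine hno {v} (fun _ => True) ⟨Set.subset_univ _, by simp, fun h' => ?_, ?_⟩
    · have : z ∈ ({v} : Set V) := h' ▸ Set.mem_univ z
      exact hSv ((show z = v from this) ▸ hzS)
    · rintro x rfl y - - hc
      exact iff_true_intro (h y hc.symm)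
  have hmv : m ≠ v := fun h => hcm (h ▸ rfl)
  by_cases hmS : m ∈ S
  · exact hfree.not_isConn_bipCompl hs hconn hSv hadj hmS hcm hvm ⟨w, hwS, hwv⟩ hiso hco
  · refine hfree.not_isConn_bipCompl (C := {x | x ∉ S ∧ x ≠ v}) hs hconn (by simp) ?_ ⟨hmS, hmv⟩
      hcm hvm ⟨z, by simp [hzS], fun h => hSv (h ▸ hzS)⟩ hiso hco
    rintro x ⟨hx, hxv⟩ y hxy hyv
    exact ⟨fun hy => hx (hadj y hy x (hs.symm hxy) hxv), hyv⟩

/-- The orientation of the complete bipartite graph that directs the edges of the graph from colour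
`true` to colour `false` and the other pairs in the opposite direction. -/
def OrientedArc (c : V → Bool) (s : V → V → Prop) (x y : V) : Prop :=
  c x ≠ c y ∧ (s x y ↔ c x = true)

theorem IsBicoloured.isBipartiteTournament (hs : IsBicoloured c s) :
    IsBipartiteTournament c (OrientedArc c s) := by
  have hcomm : ∀ {x y}, s x y ↔ s y x := ⟨hs.symm, hs.symm⟩
  refine ⟨fun h => h.1, fun {x y} hc h => ⟨hc.symm, ?_⟩, fun {x y} h h' => ?_⟩
  · rw [OrientedArc, hcomm] at h
    revert hc h
    cases c x <;> cases c y <;> simp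
  · have h₁ := h.2
    have h₂ := h'.2
    have hc := h.1
    rw [hcomm] at h₁
    revert hc h₁ h₂
    cases c x <;> cases c y <;> simp +contextual

/-- If the two values differ, all arcs between `S` and `U \ S` point the same way. -/
theorem StrongOn.iff_of_isSplit (hs : IsBicoloured c s) {U S : Set V} {e : Bool → Prop}
    (h : StrongOn (OrientedArc c s) U) (hS : IsSplit c s U S e) : e true ↔ e false := by
  by_contra hne
  by_cases ht : e true
  · have hf : ¬ e false := fun hf => hne (iff_of_true ht hf)
    have := h (U \ S) Set.sdiff_subset ?_ ?_
    · obtain ⟨z, hz⟩ := hS.nonempty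
      exact (this.symm.subset (hS.subset hz)).2 hz
    · by_contra hemp
      rw [Set.not_nonempty_iff_eq_empty, Set.sdiff_eq_empty] at hemp
      exact hS.ne (hS.subset.antisymm hemp)
    · rintro x ⟨hx, hxS⟩ y hy hxy
      refine ⟨hy, fun hyS => ?_⟩
      refine hs.isBipartiteTournament.asymm hxy ⟨hxy.1.symm, ?_⟩
      rw [hS.iff y hyS x hx hxS hxy.1.symm]
      cases c y <;> simp [ht, hf]
  · have hf : e false := by
      by_contra hf
      exact hne (iff_of_false ht hf)
    refine hS.ne (h S hS.subset hS.nonempty fun x hx y hy hxy => ?_)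
    by_contra hyS
    have := hxy.2
    rw [hS.iff x hx y hy hyS hxy.1] at this
    revert this
    cases c x <;> simp [ht, hf]

theorem IsP7S123Free.comp (hfree : IsP7S123Free c s) {W : Type*} (f : W → V) :
    IsP7S123Free (c ∘ f) fun x y => s (f x) (f y) :=
  ⟨hfree.path, hfree.star⟩

theorem IsBicoloured.comp (hs : IsBicoloured c s) {W : Type*} (f : W → V) :
    IsBicoloured (c ∘ f) fun x y => s (f x) (f y) :=
  ⟨hs.symm, hs.ne⟩

/-- Every `(P_7, S_{1,2,3})`-free bipartite graph with at least two vertices has a split. -/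
theorem IsP7S123Free.exists_isSplit [Finite V] [Nontrivial V] (hs : IsBicoloured c s)
    (hfree : IsP7S123Free c s) : ∃ S e, IsSplit c s Set.univ S e := by
  induction hn : Nat.card V using Nat.strong_induction_on generalizing V with
  | _ n ih =>
    by_contra! hno
    have hstrong : StrongOn (OrientedArc c s) Set.univ := by
      intro R _ hne hR
      by_contra hR'
      refine hno R (fun k => k = false) ⟨Set.subset_univ _, hne, hR', fun x hx y _ hy hc => ?_⟩
      have : ¬ (s x y ↔ c x = true) := fun h => hy (hR x hx y trivial ⟨hc, h⟩)
      revert this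
      cases c x <;> simp
    rcases hs.isBipartiteTournament.exists_strongOn_compl_singleton hstrong with
      ⟨v, hv⟩ | ⟨x₁, x₂, hc, ⟨w, hw⟩, h⟩
    · have hv' := fun S e (hS : IsSplit c s {v}ᶜ S e) => hv.iff_of_isSplit hs hS
      obtain ⟨S, e, hS⟩ : ∃ S e, IsSplit c s {v}ᶜ S e := by
        have hnt : Nontrivial {x // x ≠ v} := by
          by_contra hsub
          rw [not_nontrivial_iff_subsingleton] at hsub
          obtain ⟨w, hw⟩ := exists_ne v
          refine hno {v} (fun _ => s v w) ⟨Set.subset_univ _, by simp, fun h => ?_, ?_⟩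
          · exact hw (h.symm.subset (Set.mem_univ w))
          · rintro x rfl y - hy -
            have : y = w := congrArg Subtype.val (Subsingleton.elim
              (⟨y, hy⟩ : {y // y ≠ x}) ⟨w, hw⟩)
            rw [this]
        obtain ⟨S, e, hS⟩ := ih _ (hn ▸ Finite.card_subtype_lt (p := (· ≠ v)) (x := v) (by simp))
          (hs.comp Subtype.val) (hfree.comp (Subtype.val : {x // x ≠ v} → V)) rfl
        refine ⟨Subtype.val '' S, e, ?_, hS.nonempty.image _, fun h => ?_, ?_⟩
        · rintro _ ⟨x, -, rfl⟩
          exact x.2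
        · refine hS.ne (Set.eq_univ_of_forall fun x => ?_)
          obtain ⟨y, hy, hyx⟩ := h.symm.subset x.2
          rwa [← Subtype.ext hyx]
        · rintro _ ⟨x, hx, rfl⟩ y hy hyS hc
          exact hS.iff x hx ⟨y, hy⟩ trivial (fun h => hyS ⟨_, h, rfl⟩) hc
      have he := hv' S e hS
      by_cases ht : e true
      · obtain ⟨S', e', h'⟩ := hfree.bipCompl.exists_isSplit_of_disconnected hs.bipCompl
          (fun S e h => not_iff_not.1 (hv' _ _ h.of_bipCompl)) hS.bipCompl
          (Bool.forall_bool.2 ⟨not_not.2 (he.1 ht), not_not.2 ht⟩)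
        exact hno _ _ h'.of_bipCompl
      · obtain ⟨S', e', h'⟩ := hfree.exists_isSplit_of_disconnected hs hv' hS
          (Bool.forall_bool.2 ⟨fun h => ht (he.2 h), ht⟩)
        exact hno _ _ h'
    -- The colours of `x₁` and `x₂` differ and their arcs point in opposite directions, so both are
    -- complete or both anticomplete to the opposite colour in the rest.
    · refine hno {x₁, x₂} (fun _ => c x₁ = false) ⟨Set.subset_univ _, by simp, fun h => ?_, ?_⟩
      · exact hw (h.symm.subset (Set.mem_univ w))
      · rintro x hx y - hy hxy
        simp only [Set.mem_insert_iff, Set.mem_singleton_iff, not_or] at hx hy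
        obtain ⟨h₁, h₂⟩ := h y hy.1 hy.2
        rcases hx with rfl | rfl
        · have h₃ := (h₁ hxy.symm).2
          rw [show s y x ↔ s x y from ⟨hs.symm, hs.symm⟩] at h₃
          revert hxy h₃
          cases c x <;> cases c y <;> simp
        · have h₃ := (h₂ hxy.symm).2
          revert hc h₃
          cases c x₁ <;> cases c x <;> simp

end Split

/-! ### Minimal bad sequences -/

section MinimalBadSequence

variable {α : Type*} {r : α → α → Prop}

/-- Smaller elements below the terms of a minimal bad sequence are well-quasi-ordered. -/
theorem Set.PartiallyWellOrderedOn.IsMinBadSeq.wellQuasiOrdered [IsTrans α r] {rk : α → ℕ}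
    {f P : ℕ → α} (hf : IsBadSeq r Set.univ f) (hmin : ∀ n, IsMinBadSeq r rk Set.univ n f)
    (hP : ∀ n, r (P n) (f n)) (hrk : ∀ n, rk (P n) < rk (f n)) :
    WellQuasiOrdered fun m n => r (P m) (P n) := by
  intro h
  by_contra! hbad
  obtain ⟨_, ⟨i₀, rfl⟩, hi₀⟩ := WellFounded.has_min (wellFounded_lt (α := ℕ)) (Set.range h)
    ⟨h 0, 0, rfl⟩
  have hle : ∀ i, h i₀ ≤ h i := fun i => not_lt.1 (hi₀ _ ⟨i, rfl⟩)
  -- Splice `P` along `h` into `f` at the least index occurring in `h`: a comparison of `f m` with a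
  -- later `P (h i)` then yields `f m` below `f (h i)` with `m < h i`.
  refine hmin (h i₀) (fun m => if m < h i₀ then f m else P (h (i₀ + (m - h i₀))))
    (fun m hm => by simp [hm]) (by simpa using hrk _) ⟨fun _ => trivial, fun m n hmn hr => ?_⟩
  by_cases hn : n < h i₀
  · simp only [hn, hmn.trans hn, if_true] at hr
    exact hf.2 m n hmn hr
  by_cases hm : m < h i₀
  · simp only [hm, hn, if_true, if_false] at hr
    exact hf.2 m _ (hm.trans_le (hle _)) (_root_.trans hr (hP _))
  · simp only [hm, hn, if_false] at hr
    exact hbad _ _ (by omega) hr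

end MinimalBadSequence

/-! ### Well-quasi-ordering of coloured graphs -/

/-- A finite `(P_7, S_{1,2,3})`-free bipartite graph together with a proper `2`-colouring. -/
structure ColouredGraph : Type (u + 1) where
  V : Type u
  finite : Finite V
  colour : V → Bool
  adj : V → V → Prop
  isBicoloured : IsBicoloured colour adj
  free : IsP7S123Free colour adj

namespace ColouredGraph

/-- Embeddability as an induced subgraph, with colours preserved. -/
def Embeds (G H : ColouredGraph.{u}) : Prop :=
  ∃ f : G.V → H.V, f.Injective ∧ (∀ x, H.colour (f x) = G.colour x) ∧
    ∀ x y, G.adj x y ↔ H.adj (f x) (f y)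

instance : IsPreorder ColouredGraph.{u} Embeds where
  refl _ := ⟨id, Function.injective_id, fun _ => rfl, fun _ _ => Iff.rfl⟩
  trans _ _ _ := fun ⟨f, hf, hfc, hfa⟩ ⟨g, hg, hgc, hga⟩ =>
    ⟨g ∘ f, hg.comp hf, fun x => (hgc _).trans (hfc x), fun x y => (hfa x y).trans (hga _ _)⟩

/-- The subgraph induced by a set of vertices. -/
def induce (G : ColouredGraph.{u}) (S : Set G.V) : ColouredGraph.{u} where
  V := S
  finite := have := G.finite; inferInstance
  colour := G.colour ∘ (↑)
  adj x y := G.adj x y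
  isBicoloured := G.isBicoloured.comp _
  free := G.free.comp _

theorem induce_embeds (G : ColouredGraph.{u}) (S : Set G.V) : (G.induce S).Embeds G :=
  ⟨Subtype.val, Subtype.val_injective, fun _ => rfl, fun _ _ => Iff.rfl⟩

theorem card_induce_lt (G : ColouredGraph.{u}) {S : Set G.V} (hS : S ≠ Set.univ) :
    Nat.card (G.induce S).V < Nat.card G.V := by
  have := G.finite
  obtain ⟨x, hx⟩ := (Set.ne_univ_iff_exists_notMem S).1 hS
  exact Finite.card_subtype_lt hx

/-- Adjacency across the split is read off from `e` and the colours, which both embeddings preserve,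
so their union is an embedding. -/
theorem embeds_of_isSplit {G H : ColouredGraph.{u}} {S : Set G.V} {S' : Set H.V} {e : Bool → Prop}
    (hS : IsSplit G.colour G.adj Set.univ S e) (hS' : IsSplit H.colour H.adj Set.univ S' e)
    (h₁ : (G.induce S).Embeds (H.induce S')) (h₂ : (G.induce Sᶜ).Embeds (H.induce S'ᶜ)) :
    G.Embeds H := by
  classical
  obtain ⟨f, hf, hfc, hfa⟩ := h₁
  obtain ⟨g, hg, hgc, hga⟩ := h₂
  let F : G.V → H.V := fun x => if hx : x ∈ S then (f ⟨x, hx⟩).1 else (g ⟨x, hx⟩).1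
  have F₁ : ∀ x (hx : x ∈ S), F x = (f ⟨x, hx⟩).1 := fun x hx => dif_pos hx
  have F₂ : ∀ x (hx : x ∉ S), F x = (g ⟨x, hx⟩).1 := fun x hx => dif_neg hx
  have M₁ : ∀ x ∈ S, F x ∈ S' := fun x hx => F₁ x hx ▸ (f ⟨x, hx⟩).2
  have M₂ : ∀ x ∉ S, F x ∉ S' := fun x hx => F₂ x hx ▸ (g ⟨x, hx⟩).2
  have hFc : ∀ x, H.colour (F x) = G.colour x := by
    intro x
    by_cases hx : x ∈ S
    · exact F₁ x hx ▸ hfc ⟨x, hx⟩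
    · exact F₂ x hx ▸ hgc ⟨x, hx⟩
  have hcross : ∀ x ∈ S, ∀ y ∉ S, (G.adj x y ↔ H.adj (F x) (F y)) := by
    intro x hx y hy
    by_cases hc : G.colour x = G.colour y
    · exact iff_of_false (fun h => G.isBicoloured.ne h hc) fun h =>
        H.isBicoloured.ne h (by rw [hFc, hFc, hc])
    · rw [hS.iff x hx y trivial hy hc, hS'.iff _ (M₁ x hx) _ trivial (M₂ y hy)
        (by rwa [hFc, hFc]), hFc]
  have hG : ∀ {x y}, G.adj x y ↔ G.adj y x := ⟨G.isBicoloured.symm, G.isBicoloured.symm⟩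
  have hH : ∀ {x y}, H.adj x y ↔ H.adj y x := ⟨H.isBicoloured.symm, H.isBicoloured.symm⟩
  refine ⟨F, fun x y hxy => ?_, hFc, fun x y => ?_⟩
  · by_cases hx : x ∈ S <;> by_cases hy : y ∈ S
    · rw [F₁ x hx, F₁ y hy] at hxy
      exact congrArg Subtype.val (hf (Subtype.ext hxy))
    · exact absurd (hxy ▸ M₁ x hx) (M₂ y hy)
    · exact absurd (hxy ▸ M₁ y hy) (M₂ x hx)
    · rw [F₂ x hx, F₂ y hy] at hxy
      exact congrArg Subtype.val (hg (Subtype.ext hxy))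
  · by_cases hx : x ∈ S <;> by_cases hy : y ∈ S
    · rw [F₁ x hx, F₁ y hy]
      exact hfa ⟨x, hx⟩ ⟨y, hy⟩
    · exact hcross x hx y hy
    · rw [hG, hH]
      exact hcross y hy x hx
    · rw [F₂ x hx, F₂ y hy]
      exact hga ⟨x, hx⟩ ⟨y, hy⟩

/-- `G` is composed of `P` and `Q` by a split of type `e`, or is a vertex of colour `k`. -/
inductive IsComposed (G : ColouredGraph.{u}) :
    ColouredGraph.{u} → ColouredGraph.{u} → (Bool → Prop) ⊕ Bool → Prop
  | split {S : Set G.V} {e : Bool → Prop} (h : IsSplit G.colour G.adj Set.univ S e) :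
      IsComposed G (G.induce S) (G.induce Sᶜ) (Sum.inl e)
  -- The empty pieces are placeholders: they are smaller than `G`, so both cases fit the same
  -- argument.
  | vertex (x : G.V) (h : ∀ y, y = x) :
      IsComposed G (G.induce ∅) (G.induce ∅) (Sum.inr (G.colour x))

theorem IsComposed.embeds {G H P Q P' Q' : ColouredGraph.{u}} {l : (Bool → Prop) ⊕ Bool}
    (hG : G.IsComposed P Q l) (hH : H.IsComposed P' Q' l) (h₁ : P.Embeds P') (h₂ : Q.Embeds Q') :
    G.Embeds H := by
  generalize hl : l = l' at hH
  rcases hG with h | ⟨x, hx⟩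
  · rcases hH with h' | ⟨x', hx'⟩
    · cases hl
      exact embeds_of_isSplit h h' h₁ h₂
    · cases hl
  · rcases hH with h' | ⟨x', hx'⟩
    · cases hl
    · have hc := Sum.inr_injective hl
      refine ⟨fun _ => x', fun y z _ => (hx y).trans (hx z).symm, fun y => by rw [hx y, hc],
        fun y z => iff_of_false (fun h => ?_) fun h => H.isBicoloured.ne h rfl⟩
      exact G.isBicoloured.ne h (by rw [hx y, hx z])

theorem exists_isComposed (G : ColouredGraph.{u}) (hG : Nonempty G.V) :
    ∃ P Q l, G.IsComposed P Q l := by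
  have := G.finite
  by_cases hnt : Nontrivial G.V
  · obtain ⟨S, e, h⟩ := G.free.exists_isSplit G.isBicoloured
    exact ⟨_, _, _, .split h⟩
  · rw [not_nontrivial_iff_subsingleton] at hnt
    obtain ⟨x⟩ := hG
    exact ⟨_, _, _, .vertex x fun y => Subsingleton.elim _ _⟩

theorem IsComposed.left {G P Q : ColouredGraph.{u}} {l : (Bool → Prop) ⊕ Bool}
    (h : G.IsComposed P Q l) : P.Embeds G ∧ Nat.card P.V < Nat.card G.V := by
  rcases h with h | ⟨x, -⟩
  · exact ⟨G.induce_embeds _, G.card_induce_lt h.ne⟩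
  · exact ⟨G.induce_embeds _, G.card_induce_lt fun e =>
      Set.notMem_empty x (e ▸ Set.mem_univ x)⟩

theorem IsComposed.right {G P Q : ColouredGraph.{u}} {l : (Bool → Prop) ⊕ Bool}
    (h : G.IsComposed P Q l) : Q.Embeds G ∧ Nat.card Q.V < Nat.card G.V := by
  rcases h with h | ⟨x, -⟩
  · exact ⟨G.induce_embeds _, G.card_induce_lt fun e =>
      h.nonempty.ne_empty (Set.compl_univ_iff.1 e)⟩
  · exact ⟨G.induce_embeds _, G.card_induce_lt fun e =>
      Set.notMem_empty x (e ▸ Set.mem_univ x)⟩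

theorem wellQuasiOrdered_embeds : WellQuasiOrdered Embeds.{u} := by
  rw [← Set.partiallyWellOrderedOn_univ_iff,
    Set.PartiallyWellOrderedOn.iff_not_exists_isMinBadSeq fun G => Nat.card G.V]
  rintro ⟨f, hf, hmin⟩
  have hne : ∀ n, Nonempty (f n).V := fun n => by
    by_contra hemp
    rw [not_nonempty_iff] at hemp
    exact hf.2 n (n + 1) n.lt_succ_self
      ⟨isEmptyElim, isEmptyElim, isEmptyElim, isEmptyElim⟩
  choose P Q l h using fun n => (f n).exists_isComposed (hne n)
  have hP := Set.PartiallyWellOrderedOn.IsMinBadSeq.wellQuasiOrdered hf hmin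
    (fun n => (h n).left.1) fun n => (h n).left.2
  have hQ := Set.PartiallyWellOrderedOn.IsMinBadSeq.wellQuasiOrdered hf hmin
    (fun n => (h n).right.1) fun n => (h n).right.2
  have : IsPreorder ℕ fun m n => (P m).Embeds (P n) :=
    { refl := fun n => refl_of Embeds (P n), trans := fun _ _ _ => trans_of Embeds }
  have : IsPreorder ℕ fun m n => (Q m).Embeds (Q n) :=
    { refl := fun n => refl_of Embeds (Q n), trans := fun _ _ _ => trans_of Embeds }
  -- There are only six labels: four split patterns and two colours.
  have hl : WellQuasiOrdered ((· = ·) : (Bool → Prop) ⊕ Bool → _ → Prop) :=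
    Finite.wellQuasiOrdered _
  obtain ⟨m, n, hmn, h₁, h₂, h₃⟩ := (hl.prod (hP.prod hQ)) fun n => (l n, n, n)
  exact hf.2 m n hmn ((h m).embeds ((show l m = l n from h₁) ▸ h n) h₂ h₃)

end ColouredGraph

/-! ### From coloured to uncoloured graphs -/

/-- Since distinct vertices of `H` have distinct neighbourhoods, `f` is automatically injective. -/
theorem SimpleGraph.isIndContained_of_forall_adj_iff {V W : Type*} {G : SimpleGraph V}
    {H : SimpleGraph W} (f : W → V) (hf : ∀ i j, G.Adj (f i) (f j) ↔ H.Adj i j)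
    (hH : ∀ i j, (∀ k, H.Adj i k ↔ H.Adj j k) → i = j) : H.IsIndContained G :=
  ⟨⟨⟨f, fun i j hij => hH i j fun k => by rw [← hf, ← hf, hij]⟩, hf _ _⟩⟩

/-- A proper `2`-colouring of a bipartite graph without induced `P_7` and `S_{1,2,3}` satisfies the
coloured version of the condition. -/
theorem isP7S123Free_of_isInducedFree {V : Type u} {G : SimpleGraph V} {c : V → Bool}
    (hc : IsBicoloured c G.Adj) (h₁ : G.IsInducedFree (SimpleGraph.pathGraph 7))
    (h₂ : G.IsInducedFree graphS123) : IsP7S123Free c G.Adj := by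
  have hsame : ∀ {k x y}, c x = k → c y = k → ¬ G.Adj x y := fun h h' e => hc.ne e (h.trans h'.symm)
  have hsame' : ∀ {k x y}, c x ≠ k → c y ≠ k → ¬ G.Adj x y := fun h h' e =>
    hc.ne e (Bool.eq_of_ne_of_ne' h h')
  constructor
  · intro k a₁ a₂ a₃ a₄ b₁ b₂ b₃ ha₁ ha₂ ha₃ ha₄ hb₁ hb₂ hb₃ e₁ e₂ e₃ e₄ e₅ e₆ e₇ e₈ e₉ e₁₀ e₁₁ e₁₂
    refine h₁ (SimpleGraph.isIndContained_of_forall_adj_iff ![a₁, b₁, a₂, b₂, a₃, b₃, a₄] ?_ ?_)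
    · intro i j
      rw [SimpleGraph.pathGraph_adj]
      fin_cases i <;> fin_cases j <;> first
        | exact iff_of_true (by assumption) (by decide)
        | exact iff_of_true (SimpleGraph.Adj.symm (by assumption)) (by decide)
        | exact iff_of_false (by assumption) (by decide)
        | exact iff_of_false (fun h => absurd h.symm (by assumption)) (by decide)
        | exact iff_of_false (hsame (k := k) (by assumption) (by assumption)) (by decide)
        | exact iff_of_false (hsame' (k := k) (by assumption) (by assumption)) (by decide)
    · simp only [SimpleGraph.pathGraph_adj]
      decide
  · intro k x l m₁ m₂ t₁ t₂ t₃ hx hm₂ ht₂ hl hm₁ ht₁ ht₃ e₁ e₂ e₃ e₄ e₅ e₆ e₇ e₈ e₉ e₁₀ e₁₁ e₁₂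
    refine h₂ (SimpleGraph.isIndContained_of_forall_adj_iff ![x, l, m₁, m₂, t₁, t₂, t₃] ?_ ?_)
    · intro i j
      rw [graphS123, SimpleGraph.fromEdgeSet_adj]
      simp only [Set.mem_insert_iff, Set.mem_singleton_iff]
      fin_cases i <;> fin_cases j <;> first
        | exact iff_of_true (by assumption) (by decide)
        | exact iff_of_true (SimpleGraph.Adj.symm (by assumption)) (by decide)
        | exact iff_of_false (by assumption) (by decide)
        | exact iff_of_false (fun h => absurd h.symm (by assumption)) (by decide)
        | exact iff_of_false (hsame (k := k) (by assumption) (by assumption)) (by decide)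
        | exact iff_of_false (hsame' (k := k) (by assumption) (by assumption)) (by decide)
    · simp only [graphS123, SimpleGraph.fromEdgeSet_adj, Set.mem_insert_iff, Set.mem_singleton_iff]
      decide

theorem mainTheorem3 :
    WellQuasiOrdered (fun G H : P7S123FreeBipartite.{u} =>
      FiniteGraph.IsInducedSubgraph G.1 H.1) := by
  have hcol : ∀ G : P7S123FreeBipartite.{u}, ∃ c : G.1.V → Bool, IsBicoloured c G.1.graph.Adj := by
    rintro ⟨G, ⟨C⟩, -⟩
    refine ⟨fun x => decide (C x = 0), fun h => h.symm, fun {x y} h => ?_⟩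
    have := C.valid h
    simp only [ne_eq, decide_eq_decide]
    have hx := C x
    revert this
    generalize C x = i
    generalize C y = j
    revert i j
    decide
  choose c hc using hcol
  intro f
  obtain ⟨m, n, hmn, g, hg, -, hga⟩ := ColouredGraph.wellQuasiOrdered_embeds fun n =>
    ⟨(f n).1.V, (f n).1.finite, c (f n), (f n).1.graph.Adj, hc _,
      isP7S123Free_of_isInducedFree (hc _) (f n).2.2.1 (f n).2.2.2⟩
  exact ⟨m, n, hmn, ⟨⟨⟨g, hg⟩, (hga _ _).symm⟩⟩⟩
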